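/- Let $\widehat{\mathbb R}=\mathbb R\cup\{\infty\}$ be the one-point compactification of $\mathbb R$ (a topological circle), and let $\text{Möb}^+(\widehat{\mathbb R})$ be the group of homeomorphisms $x\mapsto\frac{ax+b}{cx+d}$ of $\widehat{\mathbb R}$ with $a,b,c,d\in\mathbb R$ and $ad-bc=1$. All homeomorphisms are assumed to be orientation preserving, that is, to preserve the cyclic order of triples of points of $\widehat{\mathbb R}$. A family $\mathcal F$ of homeomorphisms of $\widehat{\mathbb R}$ has the *convergence property* if every infinite sequence in $\mathcal F$ has a subsequence $(f_n)$ such that either - $(f_n)$ converges uniformly on $\widehat{\mathbb R}$ to a homeomorphism of $\widehat{\mathbb R}$, or - there are points $a,r\in\widehat{\mathbb R}$, possibly equal, such that for every open neighbourhood $U$ of $r$, $(f_n)$ converges uniformly to the constant function $a$ on $\widehat{\mathbb R}\setminus U$. (Uniform convergence refers to the unique uniform structure of the compact Hausdorff space $\widehat{\mathbb R}$.) For $k>0$, a homeomorphism $f$ of $\widehat{\mathbb R}$ is *$k$-quasisymmetric* if for some $\varphi\in\text{Möb}^+(\widehat{\mathbb R})$ with $\varphi(f(\infty))=\infty$, the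 map $h=\varphi\circ f$ satisfies $$\frac1k\le\frac{h(x+t)-h(x)}{h(x)-h(x-t)}\le k\qquad\text{for all }x\in\mathbb R\text{ and all }t>0;$$ this condition does not depend on the choice of $\varphi$. The family $\mathcal F$ is *uniformly quasisymmetric* if there is a $k>0$ such that every $f\in\mathcal F$ is $k$-quasisymmetric. **Proposition.** Let $\mathcal F$ be a family of homeomorphisms of $\widehat{\mathbb R}$ such that $\varphi\circ f\in\mathcal F$ and $f\circ\varphi\in\mathcal F$ for all $f\in\mathcal F$ and all $\varphi\in\text{Möb}^+(\widehat{\mathbb R})$. Then $\mathcal F$ has the convergence property if and only if $\mathcal F$ is uniformly quasisymmetric. -/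

import Mathlib

/-- The extended real line `ℝ ∪ {∞}`, with its topology of a circle. -/
abbrev RHat : Type := OnePoint ℝ

namespace RHat

open Filter
open scoped OnePoint MatrixGroups

/-- `a, b, c` are distinct points of the extended line and are met in this cyclic order when the
line is traversed in the increasing direction (from `∞` through the reals back to `∞`). -/
def CyclicallyOrdered : RHat → RHat → RHat → Prop
  | OnePoint.some x, OnePoint.some y, OnePoint.some z =>
      (x < y ∧ y < z) ∨ (y < z ∧ z < x) ∨ (z < x ∧ x < y)
  | OnePoint.infty, OnePoint.some y, OnePoint.some z => y < z
  | OnePoint.some x, OnePoint.infty, OnePoint.some z => z < x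
  | OnePoint.some x, OnePoint.some y, OnePoint.infty => x < y
  | _, _, _ => False

/-- A homeomorphism of the extended line preserves orientation if it preserves the cyclic order
of triples of points. -/
def OrientationPreserving (f : RHat ≃ₜ RHat) : Prop :=
  ∀ a b c : RHat, CyclicallyOrdered a b c → CyclicallyOrdered (f a) (f b) (f c)

/-- The orientation preserving Möbius group of the extended line: the homeomorphisms
`x ↦ (a x + b) / (c x + d)` with `a, b, c, d` real and `a d - b c = 1`. -/
def Moeb : Set (RHat ≃ₜ RHat) :=
  {φ | ∃ A : SL(2, ℝ), ∀ x : RHat, φ x = (A : GL (Fin 2) ℝ) • x}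

/-- Uniform convergence on a set `S` of a sequence of self-maps of the extended line, for the
unique uniform structure that induces the topology of this compact Hausdorff space. -/
def UniformlyConvergesOn (f : ℕ → RHat → RHat) (g : RHat → RHat) (S : Set RHat) : Prop :=
  letI : UniformSpace RHat := uniformSpaceOfCompactR1
  TendstoUniformlyOn f g atTop S

/-- The convergence property of a family of orientation preserving homeomorphisms: every sequence
in the family has a subsequence that converges uniformly to an (orientation preserving)
homeomorphism, or that has an attractor `a` and a repeller `r`. -/
def HasConvergenceProperty (F : Set (RHat ≃ₜ RHat)) : Prop :=
  ∀ f : ℕ → (RHat ≃ₜ RHat), (∀ n, f n ∈ F) →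
    ∃ s : ℕ → ℕ, StrictMono s ∧
      ((∃ g : RHat ≃ₜ RHat, OrientationPreserving g ∧
          UniformlyConvergesOn (fun n => f (s n)) g Set.univ) ∨
        ∃ a r : RHat, ∀ U : Set RHat, IsOpen U → r ∈ U →
          UniformlyConvergesOn (fun n => f (s n)) (fun _ => a) Uᶜ)

/-- An orientation preserving homeomorphism `f` is `k`-quasisymmetric if, after post-composition
with a Möbius map `φ` such that `φ ∘ f` fixes `∞`, the map `h` that `φ ∘ f` induces on the real
line satisfies `1 / k ≤ (h (x + t) - h x) / (h x - h (x - t)) ≤ k` for all `x` and all `t > 0`. -/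
def IsQuasisymmetric (k : ℝ) (f : RHat ≃ₜ RHat) : Prop :=
  OrientationPreserving f ∧
    ∃ φ ∈ Moeb, φ (f ∞) = ∞ ∧
      ∃ h : ℝ → ℝ, (∀ x : ℝ, φ (f (x : RHat)) = (h x : RHat)) ∧
        ∀ x t : ℝ, 0 < t →
          1 / k ≤ (h (x + t) - h x) / (h x - h (x - t)) ∧
            (h (x + t) - h x) / (h x - h (x - t)) ≤ k

/-- All maps of the family are `k`-quasisymmetric for one and the same `k > 0`. -/
def UniformlyQuasisymmetric (F : Set (RHat ≃ₜ RHat)) : Prop :=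
  ∃ k : ℝ, 0 < k ∧ ∀ f ∈ F, IsQuasisymmetric k f

end RHat

namespace RHat

open Filter Topology
open scoped OnePoint MatrixGroups

/-! If `F` is uniformly quasisymmetric, each member is `ψ ∘ u` with `ψ` Möbius and `u` a
`k`-quasisymmetric map fixing `0`, `1`, `∞`. Such `u` form a compact family whose limits are again
homeomorphisms (`NormalizedQS.exists_subseq`, by Arzelà–Ascoli). The Möbius factors subconverge to a
Möbius map or collapse to a constant off one point (`moeb_exists_subseq`, by compactness of the unit
sphere of matrices). Composing the two limits gives the convergence property.

Conversely, if no `k` works, Möbius normalisation gives `g n` in `F` fixing `0`, `1`, `∞` with `g n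
(-1)` negative and outside `[-(n+1), -1/(n+1)]`. A limit homeomorphism would send `-1` to `0` or
`∞`, which are already images of `0` and `∞`. A collapse would identify two of the three fixed
points. -/

/-! ### Uniform convergence from joint limits -/

/-- For continuous `g`, joint convergence as `n → ∞` and `y → x` is local uniform convergence, and
compactness makes it uniform. Joint limits are used throughout because they compose. -/
theorem uniformlyConvergesOn_of_tendsto {f : ℕ → RHat → RHat} {g : RHat → RHat} {S : Set RHat}
    (hS : IsCompact S) (hg : ContinuousOn g S)
    (h : ∀ x ∈ S, Tendsto (fun p : ℕ × RHat => f p.1 p.2) (atTop ×ˢ 𝓝 x) (𝓝 (g x))) :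
    UniformlyConvergesOn f g S := by
  let _ : UniformSpace RHat := uniformSpaceOfCompactR1
  change TendstoUniformlyOn f g atTop S
  rw [← tendstoLocallyUniformlyOn_iff_tendstoUniformlyOn_of_compact hS,
    tendstoLocallyUniformlyOn_iff_forall_tendsto]
  intro x hx
  have h1 : Tendsto (fun p : ℕ × RHat => g p.2) (atTop ×ˢ 𝓝[S] x) (𝓝 (g x)) :=
    (hg x hx).tendsto.comp tendsto_snd
  have h2 : Tendsto (fun p : ℕ × RHat => f p.1 p.2) (atTop ×ˢ 𝓝[S] x) (𝓝 (g x)) :=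
    (h x hx).mono_left (prod_mono le_rfl nhdsWithin_le_nhds)
  exact (h1.prodMk_nhds h2).mono_right (nhds_le_uniformity _)

theorem UniformlyConvergesOn.tendsto_at {f : ℕ → RHat → RHat} {g : RHat → RHat} {S : Set RHat}
    (h : UniformlyConvergesOn f g S) {x : RHat} (hx : x ∈ S) :
    Tendsto (fun n => f n x) atTop (𝓝 (g x)) := by
  let _ : UniformSpace RHat := uniformSpaceOfCompactR1
  exact TendstoUniformlyOn.tendsto_at h hx

/-! ### Cyclic order -/

theorem cyclicallyOrdered_or {a b c : RHat} (hab : a ≠ b) (hbc : b ≠ c) (hca : c ≠ a) :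
    CyclicallyOrdered a b c ∨ CyclicallyOrdered a c b := by
  induction a using OnePoint.rec <;> induction b using OnePoint.rec <;>
    induction c using OnePoint.rec <;>
    simp_all only [ne_eq, OnePoint.coe_eq_coe, not_true_eq_false, not_false_eq_true,
      OnePoint.infty_ne_coe, OnePoint.coe_ne_infty] <;>
    simp only [CyclicallyOrdered] <;> grind

theorem CyclicallyOrdered.ne {a b c : RHat} (h : CyclicallyOrdered a b c) :
    a ≠ b ∧ b ≠ c ∧ c ≠ a := by
  induction a using OnePoint.rec <;> induction b using OnePoint.rec <;>
    induction c using OnePoint.rec <;>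
    simp only [CyclicallyOrdered] at h <;>
    simp only [ne_eq, OnePoint.coe_eq_coe, OnePoint.infty_ne_coe, OnePoint.coe_ne_infty] <;> grind

theorem CyclicallyOrdered.asymm {a b c : RHat} (h : CyclicallyOrdered a b c) :
    ¬ CyclicallyOrdered a c b := by
  intro h'
  induction a using OnePoint.rec <;> induction b using OnePoint.rec <;>
    induction c using OnePoint.rec <;>
    simp only [CyclicallyOrdered] at h h' <;> grind

theorem CyclicallyOrdered.rotate {a b c : RHat} (h : CyclicallyOrdered a b c) :
    CyclicallyOrdered b c a := by
  induction a using OnePoint.rec <;> induction b using OnePoint.rec <;>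
    induction c using OnePoint.rec <;>
    simp only [CyclicallyOrdered] at h ⊢ <;> grind

theorem image_coe_mem_nhds {x : ℝ} {s : Set ℝ} (hs : s ∈ 𝓝 x) :
    ((↑) : ℝ → RHat) '' s ∈ 𝓝 (x : RHat) := by
  rw [OnePoint.nhds_coe_eq]
  exact image_mem_map hs

/-- Up to rotation only `∞, y, z` with `y < z` and `x < y < z` occur; separating points give the
neighbourhoods. -/
theorem CyclicallyOrdered.exists_nhds {a b c : RHat} (h : CyclicallyOrdered a b c) :
    ∃ U ∈ 𝓝 a, ∃ V ∈ 𝓝 b, ∃ W ∈ 𝓝 c, ∀ x ∈ U, ∀ y ∈ V, ∀ z ∈ W, CyclicallyOrdered x y z := by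
  have rot : ∀ {a b c : RHat}, (∃ U ∈ 𝓝 a, ∃ V ∈ 𝓝 b, ∃ W ∈ 𝓝 c,
      ∀ x ∈ U, ∀ y ∈ V, ∀ z ∈ W, CyclicallyOrdered x y z) → ∃ U ∈ 𝓝 b, ∃ V ∈ 𝓝 c, ∃ W ∈ 𝓝 a,
      ∀ x ∈ U, ∀ y ∈ V, ∀ z ∈ W, CyclicallyOrdered x y z := by
    rintro a b c ⟨U, hU, V, hV, W, hW, h⟩
    exact ⟨V, hV, W, hW, U, hU, fun x hx y hy z hz => (h z hz x hx y hy).rotate⟩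
  have hinf : ∀ {y z : ℝ}, y < z → ∃ U ∈ 𝓝 (∞ : RHat), ∃ V ∈ 𝓝 (y : RHat), ∃ W ∈ 𝓝 (z : RHat),
      ∀ x ∈ U, ∀ y ∈ V, ∀ z ∈ W, CyclicallyOrdered x y z := by
    intro y z hyz
    obtain ⟨m, h1, h2⟩ := exists_between hyz
    refine ⟨(((↑) : ℝ → RHat) '' Set.Icc (y - 1) (z + 1))ᶜ,
      (OnePoint.isOpen_compl_image_coe.2 ⟨isClosed_Icc, isCompact_Icc⟩).mem_nhds (by simp),
      _, image_coe_mem_nhds (Ioo_mem_nhds (sub_one_lt y) h1),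
      _, image_coe_mem_nhds (Ioo_mem_nhds h2 (lt_add_one z)), ?_⟩
    rintro x hx _ ⟨y', hy, rfl⟩ _ ⟨z', hz, rfl⟩
    simp only [Set.mem_Ioo] at hy hz
    induction x using OnePoint.rec with
    | infty => simp only [CyclicallyOrdered]; linarith
    | coe x =>
      simp only [Set.mem_compl_iff, Set.mem_image, OnePoint.coe_eq_coe, exists_eq_right,
        Set.mem_Icc, not_and_or, not_le] at hx
      simp only [CyclicallyOrdered]
      grind
  have hfin : ∀ {x y z : ℝ}, x < y → y < z → ∃ U ∈ 𝓝 (x : RHat), ∃ V ∈ 𝓝 (y : RHat),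
      ∃ W ∈ 𝓝 (z : RHat), ∀ x ∈ U, ∀ y ∈ V, ∀ z ∈ W, CyclicallyOrdered x y z := by
    intro x y z hxy hyz
    obtain ⟨m, h1, h2⟩ := exists_between hxy
    obtain ⟨m', h1', h2'⟩ := exists_between hyz
    refine ⟨_, image_coe_mem_nhds (Iio_mem_nhds h1), _, image_coe_mem_nhds (Ioo_mem_nhds h2 h1'),
      _, image_coe_mem_nhds (Ioi_mem_nhds h2'), ?_⟩
    rintro _ ⟨x', hx, rfl⟩ _ ⟨y', hy, rfl⟩ _ ⟨z', hz, rfl⟩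
    simp only [Set.mem_Ioo, Set.mem_Iio, Set.mem_Ioi] at hx hy hz
    exact Or.inl ⟨hx.trans hy.1, hy.2.trans hz⟩
  induction a using OnePoint.rec <;> induction b using OnePoint.rec <;>
    induction c using OnePoint.rec <;> simp only [CyclicallyOrdered] at h
  · exact hinf h
  · exact rot (rot (hinf h))
  · exact rot (hinf h)
  · rcases h with h | h | h
    · exact hfin h.1 h.2
    · exact rot (rot (hfin h.1 h.2))
    · exact rot (hfin h.1 h.2)

/-- If the limit reversed a triple, openness of the cyclic order would make some `f n` reverse it
too. -/
theorem OrientationPreserving.of_tendsto {f : ℕ → RHat ≃ₜ RHat} {g : RHat ≃ₜ RHat}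
    (hf : ∀ n, OrientationPreserving (f n))
    (h : ∀ x, Tendsto (fun n => f n x) atTop (𝓝 (g x))) : OrientationPreserving g := by
  intro a b c habc
  obtain ⟨h1, h2, h3⟩ := habc.ne
  refine (cyclicallyOrdered_or (g.injective.ne h1) (g.injective.ne h2)
    (g.injective.ne h3)).resolve_right fun h' => ?_
  obtain ⟨U, hU, V, hV, W, hW, H⟩ := h'.exists_nhds
  obtain ⟨n, ⟨h1, h2⟩, h3⟩ := ((((h a).eventually hU).and
    ((h c).eventually hV)).and ((h b).eventually hW)).exists
  exact (hf n a b c habc).asymm (H _ h1 _ h2 _ h3)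

/-! ### Homogeneous coordinates -/

/-- The point of the extended line with homogeneous coordinates `(u : v)`. -/
noncomputable def proj (p : ℝ × ℝ) : RHat := if p.2 = 0 then ∞ else ((p.1 / p.2 : ℝ) : RHat)

theorem proj_smul {c : ℝ} (hc : c ≠ 0) (p : ℝ × ℝ) : proj (c • p) = proj p := by
  simp only [proj, Prod.smul_fst, Prod.smul_snd, smul_eq_mul, mul_eq_zero, hc, false_or]
  rw [mul_div_mul_left _ _ hc]

/-- Standard homogeneous coordinates. -/
noncomputable def vec : RHat → ℝ × ℝ
  | OnePoint.some x => (x, 1)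
  | OnePoint.infty => (1, 0)

@[simp] theorem vec_infty : vec ∞ = (1, 0) := rfl
@[simp] theorem vec_coe (x : ℝ) : vec (x : RHat) = (x, 1) := rfl

/-- The action of a matrix on homogeneous coordinates. -/
def act (M : Fin 2 → Fin 2 → ℝ) (p : ℝ × ℝ) : ℝ × ℝ :=
  (M 0 0 * p.1 + M 0 1 * p.2, M 1 0 * p.1 + M 1 1 * p.2)

theorem smul_eq_proj (A : SL(2, ℝ)) (x : RHat) :
    (A : GL (Fin 2) ℝ) • x = proj (act (fun i j => A i j) (vec x)) := by
  induction x using OnePoint.rec with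
  | infty =>
    simp only [OnePoint.smul_infty_eq_ite, proj, act, vec_infty, mul_one, mul_zero, add_zero]
    split_ifs <;> first | rfl | contradiction
  | coe x =>
    simp only [OnePoint.smul_some_eq_ite, proj, act, vec_coe, mul_one]
    split_ifs <;> first | rfl | contradiction

theorem smul_proj (A : SL(2, ℝ)) {p : ℝ × ℝ} (hp : p ≠ 0) :
    (A : GL (Fin 2) ℝ) • proj p = proj (act (fun i j => A i j) p) := by
  rw [smul_eq_proj]
  obtain ⟨u, v⟩ := p
  by_cases hv : v = 0
  · have hu : u ≠ 0 := by rintro rfl; simp [hv] at hp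
    rw [← proj_smul hu]
    simp [hv, proj, act, mul_comm]
  · rw [← proj_smul hv]
    congr 1
    simp [hv, proj, act]
    constructor <;> field_simp

theorem proj_continuousAt {p : ℝ × ℝ} (hp : p ≠ 0) : ContinuousAt proj p := by
  obtain ⟨u, v⟩ := p
  by_cases hv : v = 0
  · have hu : u ≠ 0 := by rintro rfl; simp [hv] at hp
    subst hv
    have e : proj (u, 0) = ∞ := by simp [proj]
    rw [ContinuousAt, e, Tendsto, OnePoint.le_nhds_infty]
    intro s hs hs'
    obtain ⟨R, hR⟩ := hs'.isBounded.exists_norm_le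
    -- Negativity of this expression forces `|q.1 / q.2| > R` whenever `q.2 ≠ 0`.
    have h1 : Tendsto (fun q : ℝ × ℝ => (|R| + 1) * |q.2| - |q.1|) (𝓝 (u, 0))
        (𝓝 ((|R| + 1) * |0| - |u|)) := by
      have : Continuous (fun q : ℝ × ℝ => (|R| + 1) * |q.2| - |q.1|) := by fun_prop
      exact this.tendsto (u, 0)
    have h2 := h1.eventually_lt_const (u := 0) (by simpa using hu)
    rw [mem_map]
    filter_upwards [h2] with q hq
    rw [Set.mem_preimage, ← OnePoint.compl_image_coe]
    rintro ⟨y, hy, hyq⟩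
    by_cases hq2 : q.2 = 0
    · simp [proj, hq2] at hyq
    · simp only [proj, hq2, if_false, OnePoint.coe_eq_coe] at hyq
      have := hR y hy
      rw [hyq, Real.norm_eq_abs, abs_div, div_le_iff₀ (abs_pos.2 hq2)] at this
      have h3 := le_abs_self R
      have h4 := abs_pos.2 hq2
      nlinarith
  · have h1 : ContinuousAt (fun q : ℝ × ℝ => ((q.1 / q.2 : ℝ) : RHat)) (u, v) := by
      refine OnePoint.continuous_coe.continuousAt.comp ?_
      exact continuousAt_fst.div continuousAt_snd hv
    refine h1.congr ?_
    have : ∀ᶠ q : ℝ × ℝ in 𝓝 (u, v), q.2 ≠ 0 := continuousAt_snd.eventually_ne hv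
    filter_upwards [this] with q hq
    simp [proj, hq]

/-- `vec` is discontinuous at `∞`, and no nonvanishing lift is continuous everywhere, so the lift
depends on `x`. Near `∞` it is `(1, y⁻¹)`, with `0` treated apart because `0⁻¹ = 0` would give
coordinates of `∞`. -/
theorem exists_section (x : RHat) :
    ∃ σ : RHat → ℝ × ℝ, σ x = vec x ∧ (∀ y, σ y ≠ 0 ∧ proj (σ y) = y) ∧ ContinuousAt σ x := by
  induction x using OnePoint.rec with
  | coe x =>
    refine ⟨vec, rfl, fun y => ?_, ?_⟩
    · induction y using OnePoint.rec <;> simp [proj]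
    · rw [OnePoint.continuousAt_coe]
      have : Continuous (fun y : ℝ => (y, (1 : ℝ))) := by fun_prop
      exact this.continuousAt
  | infty =>
    classical
    let τ : ℝ → ℝ × ℝ := fun y => if y = 0 then (0, 1) else (1, y⁻¹)
    refine ⟨fun y => y.elim (1, 0) τ, rfl, fun y => ?_, ?_⟩
    · induction y using OnePoint.rec with
      | infty => simp [proj]
      | coe y => by_cases hy : y = 0 <;> simp [τ, proj, hy]
    · rw [OnePoint.continuousAt_infty']
      have h1 : Tendsto (fun y : ℝ => ((1 : ℝ), y⁻¹)) (coclosedCompact ℝ) (𝓝 (1, 0)) := by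
        rw [coclosedCompact_eq_cocompact, ← Metric.cobounded_eq_cocompact]
        exact tendsto_const_nhds.prodMk_nhds tendsto_inv₀_cobounded
      refine h1.congr' ?_
      have : ∀ᶠ y : ℝ in coclosedCompact ℝ, y ≠ 0 := by
        rw [coclosedCompact_eq_cocompact]
        exact (isCompact_singleton (x := (0 : ℝ))).compl_mem_cocompact
      filter_upwards [this] with y hy
      simp [τ, hy]

/-- Scaling does not change the projective action, so the matrices may be renormalised. The limit
`B` may be singular: only `x` outside its kernel is needed. -/
theorem tendsto_smul_of_tendsto {A : ℕ → SL(2, ℝ)} {c : ℕ → ℝ} (hc : ∀ n, c n ≠ 0)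
    {B : Fin 2 → Fin 2 → ℝ}
    (h : Tendsto (fun n => (c n • fun i j => A n i j : Fin 2 → Fin 2 → ℝ)) atTop (𝓝 B)) {x : RHat}
    (hx : act B (vec x) ≠ 0) :
    Tendsto (fun p : ℕ × RHat => (A p.1 : GL (Fin 2) ℝ) • p.2) (atTop ×ˢ 𝓝 x)
      (𝓝 (proj (act B (vec x)))) := by
  obtain ⟨σ, h0, h1, h2⟩ := exists_section x
  have key : (fun p : ℕ × RHat => (A p.1 : GL (Fin 2) ℝ) • p.2) = fun p : ℕ × RHat =>
      proj (act (c p.1 • fun i j => A p.1 i j) (σ p.2)) := by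
    funext p
    conv_lhs => rw [← (h1 p.2).2, smul_proj _ (h1 p.2).1, ← proj_smul (hc p.1)]
    congr 1
    simp [act, mul_add, mul_assoc]
  rw [key]
  refine (proj_continuousAt hx).tendsto.comp ?_
  have hact : Continuous (fun q : (Fin 2 → Fin 2 → ℝ) × ℝ × ℝ => act q.1 q.2) := by
    unfold act; fun_prop
  rw [← h0]
  exact (hact.tendsto (B, σ x)).comp
    ((h.comp tendsto_fst).prodMk_nhds (h2.tendsto.comp tendsto_snd))

theorem continuous_smul (A : SL(2, ℝ)) :
    Continuous (fun x : RHat => (A : GL (Fin 2) ℝ) • x) := by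
  rw [continuous_iff_continuousAt]
  intro x
  obtain ⟨σ, h0, h1, h2⟩ := exists_section x
  have key : (fun x : RHat => (A : GL (Fin 2) ℝ) • x) = fun x =>
      proj (act (fun i j => A i j) (σ x)) := by
    funext p
    conv_lhs => rw [← (h1 p).2, smul_proj _ (h1 p).1]
  rw [key]
  have hact : Continuous (fun q : ℝ × ℝ => act (fun i j => A i j) q) := by
    unfold act; fun_prop
  refine ContinuousAt.comp (g := proj) (proj_continuousAt ?_) (hact.continuousAt.comp h2)
  intro h
  have hd := A.det_coe
  rw [Matrix.det_fin_two] at hd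
  have hσ := (h1 x).1
  simp only [act, Prod.mk_eq_zero] at h
  refine hσ (Prod.ext ?_ ?_)
  -- Multiplication by the adjugate matrix recovers the vector.
  · simp only [Prod.fst_zero]; linear_combination (-(σ x).1) * hd + A 1 1 * h.1 - A 0 1 * h.2
  · simp only [Prod.snd_zero]; linear_combination (-(σ x).2) * hd - A 1 0 * h.1 + A 0 0 * h.2

/-- The Möbius map of a matrix. -/
noncomputable def moeb (A : SL(2, ℝ)) : RHat ≃ₜ RHat where
  toFun x := (A : GL (Fin 2) ℝ) • x
  invFun x := ((A⁻¹ : SL(2, ℝ)) : GL (Fin 2) ℝ) • x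
  left_inv x := by simp
  right_inv x := by simp
  continuous_toFun := continuous_smul A
  continuous_invFun := continuous_smul A⁻¹

theorem moeb_apply (A : SL(2, ℝ)) (x : RHat) : moeb A x = (A : GL (Fin 2) ℝ) • x := rfl

theorem moeb_mem (A : SL(2, ℝ)) : moeb A ∈ Moeb := ⟨A, fun _ => rfl⟩

theorem Moeb.symm_mem {φ : RHat ≃ₜ RHat} (h : φ ∈ Moeb) : φ.symm ∈ Moeb := by
  obtain ⟨A, hA⟩ := h
  refine ⟨A⁻¹, fun x => ?_⟩
  rw [Homeomorph.symm_apply_eq, hA]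
  simp

theorem Moeb.trans_mem {φ ψ : RHat ≃ₜ RHat} (h : φ ∈ Moeb) (h' : ψ ∈ Moeb) :
    φ.trans ψ ∈ Moeb := by
  obtain ⟨A, hA⟩ := h
  obtain ⟨B, hB⟩ := h'
  refine ⟨B * A, fun x => ?_⟩
  simp [hA, hB, mul_smul]

theorem exists_moeb (a b c d : ℝ) (h : a * d - b * c = 1) :
    ∃ φ ∈ Moeb, ∀ x, φ x = proj (a * (vec x).1 + b * (vec x).2, c * (vec x).1 + d * (vec x).2) :=
  ⟨moeb ⟨!![a, b; c, d], by simpa [Matrix.det_fin_two] using h⟩, moeb_mem _, fun _ =>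
    smul_eq_proj _ _⟩

/-- Increasing affine maps are Möbius. -/
theorem exists_moeb_affine {a : ℝ} (ha : 0 < a) (b : ℝ) :
    ∃ φ ∈ Moeb, φ ∞ = ∞ ∧ ∀ x : ℝ, φ (x : RHat) = ((a * x + b : ℝ) : RHat) := by
  have hs : 0 < √a := Real.sqrt_pos.2 ha
  have hs2 : √a * √a = a := Real.mul_self_sqrt ha.le
  obtain ⟨φ, hφ, h⟩ := exists_moeb (√a) (b / √a) 0 (√a)⁻¹ (by simp [hs.ne'])
  refine ⟨φ, hφ, by simp [h, proj], fun x => ?_⟩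
  rw [h, ← proj_smul hs.ne', proj]
  simp only [vec_coe, Prod.smul_mk, smul_eq_mul, zero_mul, zero_add, mul_one, mul_add,
    mul_inv_cancel₀ hs.ne', one_ne_zero, if_false, div_one, mul_div_cancel₀ _ hs.ne',
    ← mul_assoc, hs2]

theorem exists_moeb_map_infty (x : RHat) : ∃ φ ∈ Moeb, φ x = ∞ := by
  induction x using OnePoint.rec with
  | infty => obtain ⟨φ, h, h', -⟩ := exists_moeb_affine one_pos 0; exact ⟨φ, h, h'⟩
  | coe x =>
    obtain ⟨φ, hφ, h⟩ := exists_moeb 0 (-1) 1 (-x) (by simp)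
    exact ⟨φ, hφ, by simp [h, proj]⟩

/-- A nonzero singular matrix has rank one, `B = u wᵀ`: the attractor is the line of `u`, the
repeller the kernel, spanned by `(w.2, -w.1)`. -/
theorem exists_attractor_repeller {B : Fin 2 → Fin 2 → ℝ} (hB : B ≠ 0)
    (hd : B 0 0 * B 1 1 - B 0 1 * B 1 0 = 0) :
    ∃ a r : RHat, ∀ x ≠ r, act B (vec x) ≠ 0 ∧ proj (act B (vec x)) = a := by
  obtain ⟨u, w, hu, hw, h⟩ : ∃ u w : ℝ × ℝ, u ≠ 0 ∧ w ≠ 0 ∧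
      ∀ p, act B p = (w.1 * p.1 + w.2 * p.2) • u := by
    have aux : ∃ u w : ℝ × ℝ, B 0 0 = w.1 * u.1 ∧ B 0 1 = w.2 * u.1 ∧ B 1 0 = w.1 * u.2 ∧
        B 1 1 = w.2 * u.2 := by
      by_cases h0 : B 0 0 = 0
      · by_cases h1 : B 0 1 = 0
        · exact ⟨(0, 1), (B 1 0, B 1 1), by simp [h0, h1]⟩
        · refine ⟨(1, B 1 1 / B 0 1), (B 0 0, B 0 1), by simp, by simp, ?_, ?_⟩
          · simp only [h0]; rw [h0] at hd; simp at hd; rcases hd with hd | hd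
            · exact absurd hd h1
            · simp [hd]
          · simp; field_simp
      · refine ⟨(1, B 1 0 / B 0 0), (B 0 0, B 0 1), by simp, by simp, ?_, ?_⟩
        · simp; field_simp
        · simp; field_simp; linarith
    obtain ⟨u, w, h1, h2, h3, h4⟩ := aux
    refine ⟨u, w, ?_, ?_, fun p => ?_⟩
    · rintro rfl
      refine hB ?_
      ext i j
      fin_cases i <;> fin_cases j <;> simp_all
    · rintro rfl
      refine hB ?_
      ext i j
      fin_cases i <;> fin_cases j <;> simp_all
    · simp only [act, h1, h2, h3, h4]
      ext <;> simp <;> ring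
  refine ⟨proj u, proj (w.2, -w.1), fun x hx => ?_⟩
  rw [h]
  have : w.1 * (vec x).1 + w.2 * (vec x).2 ≠ 0 := by
    contrapose! hx
    obtain ⟨w1, w2⟩ := w
    induction x using OnePoint.rec with
    | infty =>
      simp at hx
      simp [proj, hx]
    | coe x =>
      simp at hx
      have : w1 ≠ 0 := by rintro rfl; simp_all
      simp [proj, this]
      field_simp
      linarith
  exact ⟨smul_ne_zero this hu, proj_smul this u⟩

/-- Matrices scaled to norm one subconverge to some `B ≠ 0` with `det B ≥ 0`. If `det B = 0`, the
rank-one case gives a collapse; otherwise `B / √(det B)` lies in `SL(2, ℝ)`. -/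
theorem moeb_exists_subseq {φ : ℕ → RHat ≃ₜ RHat} (hφ : ∀ n, φ n ∈ Moeb) :
    ∃ s : ℕ → ℕ, StrictMono s ∧
      ((∃ ψ ∈ Moeb, ∀ x,
        Tendsto (fun p : ℕ × RHat => φ (s p.1) p.2) (atTop ×ˢ 𝓝 x) (𝓝 (ψ x))) ∨
      ∃ a r : RHat, ∀ x ≠ r,
        Tendsto (fun p : ℕ × RHat => φ (s p.1) p.2) (atTop ×ˢ 𝓝 x) (𝓝 a)) := by
  choose A hA using hφ
  let v : ℕ → Fin 2 → Fin 2 → ℝ := fun n i j => A n i j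
  have hdet : ∀ n, v n 0 0 * v n 1 1 - v n 0 1 * v n 1 0 = 1 := fun n => by
    have := (A n).det_coe
    rwa [Matrix.det_fin_two] at this
  have hv : ∀ n, v n ≠ 0 := fun n h => by
    have := hdet n
    simp [h] at this
  have hc : ∀ n, ‖v n‖⁻¹ ≠ 0 := fun n => inv_ne_zero (norm_ne_zero_iff.2 (hv n))
  obtain ⟨B, hB, s, hs, hlim⟩ :=
    (isCompact_sphere (0 : Fin 2 → Fin 2 → ℝ) 1).tendsto_subseq (x := fun n => ‖v n‖⁻¹ • v n)
      (fun n => by simp [norm_smul, hv n])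
  have hB0 : B ≠ 0 := by
    rintro rfl
    simp at hB
  have hlim' : Tendsto (fun n => ‖v (s n)‖⁻¹ • fun i j => A (s n) i j) atTop (𝓝 B) := hlim
  have key : ∀ x, act B (vec x) ≠ 0 → Tendsto (fun p : ℕ × RHat => φ (s p.1) p.2)
      (atTop ×ˢ 𝓝 x) (𝓝 (proj (act B (vec x)))) := fun x hx => by
    simp only [hA]
    exact tendsto_smul_of_tendsto (A := fun n => A (s n)) (fun n => hc (s n)) hlim' hx
  refine ⟨s, hs, ?_⟩
  by_cases hd : B 0 0 * B 1 1 - B 0 1 * B 1 0 = 0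
  · right
    obtain ⟨a, r, h⟩ := exists_attractor_repeller hB0 hd
    refine ⟨a, r, fun x hx => ?_⟩
    rw [← (h x hx).2]
    exact key x (h x hx).1
  · left
    have hpos : 0 < B 0 0 * B 1 1 - B 0 1 * B 1 0 := by
      refine lt_of_le_of_ne ?_ (Ne.symm hd)
      have hcont : Continuous fun M : Fin 2 → Fin 2 → ℝ => M 0 0 * M 1 1 - M 0 1 * M 1 0 := by
        fun_prop
      refine ge_of_tendsto' ((hcont.tendsto B).comp hlim) fun n => ?_
      have : (0 : ℝ) ≤ (‖v (s n)‖⁻¹) ^ 2 := by positivity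
      have e := hdet (s n)
      simp only [Function.comp_apply, Pi.smul_apply, smul_eq_mul]
      nlinarith
    set D := B 0 0 * B 1 1 - B 0 1 * B 1 0 with hD
    have hs : 0 < √D := Real.sqrt_pos.2 hpos
    let C : SL(2, ℝ) := ⟨Matrix.of fun i j => (√D)⁻¹ * B i j, by
      rw [Matrix.det_fin_two]
      simp only [Matrix.of_apply]
      have : √D * √D = D := Real.mul_self_sqrt hpos.le
      field_simp
      rw [sq, this]⟩
    have hC : ∀ x, act (fun i j => C i j) (vec x) = (√D)⁻¹ • act B (vec x) := fun x => by
      simp [act, C, mul_add, mul_assoc]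
    refine ⟨moeb C, moeb_mem C, fun x => ?_⟩
    rw [moeb_apply, smul_eq_proj, hC, proj_smul (inv_ne_zero hs.ne')]
    refine key x fun h => ?_
    simp only [act, Prod.mk_eq_zero] at h
    have h1 : D * (vec x).1 = 0 := by rw [hD]; linear_combination B 1 1 * h.1 - B 0 1 * h.2
    have h2 : D * (vec x).2 = 0 := by rw [hD]; linear_combination B 0 0 * h.2 - B 1 0 * h.1
    have h1' := (mul_eq_zero.1 h1).resolve_left hd
    have h2' := (mul_eq_zero.1 h2).resolve_left hd
    induction x using OnePoint.rec <;> simp_all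

/-! ### Normalised quasisymmetric maps of the line -/

/-- Increasing maps of the line that fix `0` and `1` and satisfy the quasisymmetry inequalities. -/
structure NormalizedQS (k : ℝ) (h : ℝ → ℝ) : Prop where
  mono : Monotone h
  zero : h 0 = 0
  one : h 1 = 1
  right_le : ∀ x t, 0 < t → h (x + t) - h x ≤ k * (h x - h (x - t))
  left_le : ∀ x t, 0 < t → h x - h (x - t) ≤ k * (h (x + t) - h x)

namespace NormalizedQS

variable {k : ℝ} {h : ℝ → ℝ}

theorem doubling (H : NormalizedQS k h) (x : ℝ) {t : ℝ} (ht : 0 < t) :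
    h (x + 2 * t) - h x ≤ (1 + k) * (h (x + t) - h x) := by
  have := H.right_le (x + t) t ht
  rw [show x + t + t = x + 2 * t by ring, show x + t - t = x by ring] at this
  linarith

theorem doubling_pow (H : NormalizedQS k h) (hk : 0 < k) (x : ℝ) {t : ℝ} (ht : 0 < t) (n : ℕ) :
    h (x + 2 ^ n * t) - h x ≤ (1 + k) ^ n * (h (x + t) - h x) := by
  induction n with
  | zero => simp
  | succ n ih =>
    have := H.doubling x (t := 2 ^ n * t) (by positivity)
    rw [show (2 : ℝ) ^ (n + 1) * t = 2 * (2 ^ n * t) by ring, pow_succ']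
    nlinarith

/-- The first half of the increment is at most `k` times the second. Iteration gives both a modulus
of continuity and a lower bound on growth, uniform in `h`. -/
theorem halving (H : NormalizedQS k h) (hk : 0 < k) (x : ℝ) {t : ℝ} (ht : 0 < t) :
    h (x + t) - h x ≤ k / (k + 1) * (h (x + 2 * t) - h x) := by
  have := H.left_le (x + t) t ht
  rw [show x + t + t = x + 2 * t by ring, show x + t - t = x by ring] at this
  rw [div_mul_eq_mul_div, le_div_iff₀ (by positivity)]
  linarith

theorem halving_pow (H : NormalizedQS k h) (hk : 0 < k) (x : ℝ) {t : ℝ} (ht : 0 < t) (n : ℕ) :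
    h (x + t) - h x ≤ (k / (k + 1)) ^ n * (h (x + 2 ^ n * t) - h x) := by
  induction n with
  | zero => simp
  | succ n ih =>
    have h1 := H.halving hk x (t := 2 ^ n * t) (by positivity)
    rw [show (2 : ℝ) ^ (n + 1) * t = 2 * (2 ^ n * t) by ring, pow_succ, mul_assoc]
    exact ih.trans (mul_le_mul_of_nonneg_left h1 (by positivity))

theorem abs_le (H : NormalizedQS k h) (hk : 0 < k) (x : ℝ) :
    |h x| ≤ (1 + k) * (1 + k) ^ ⌈|x|⌉₊ := by
  set n := ⌈|x|⌉₊
  -- A crude bound suffices: only independence of `h` matters.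
  have hx : |x| ≤ 2 ^ n := (Nat.le_ceil _).trans (by exact_mod_cast n.lt_two_pow_self.le)
  obtain ⟨hx1, hx2⟩ := _root_.abs_le.1 hx
  have h1 := H.doubling_pow hk 0 one_pos n
  have h2 := H.left_le 0 (2 ^ n) (by positivity)
  simp only [zero_add, zero_sub, mul_one, H.zero, H.one, sub_zero] at h1 h2
  have h3 := H.mono hx1
  have h4 := H.mono hx2
  have h5 : 0 ≤ (1 + k) ^ n := by positivity
  rw [_root_.abs_le]
  constructor <;> nlinarith

theorem abs_sub_le (H : NormalizedQS k h) (hk : 0 < k) (x : ℝ) (n : ℕ) {y : ℝ}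
    (hy : |y - x| ≤ (2 ^ n)⁻¹) :
    |h y - h x| ≤ (1 + k) * ((k / (k + 1)) ^ n * (|h (x + 1)| + |h x|)) := by
  have ht : (0 : ℝ) < (2 ^ n)⁻¹ := by positivity
  have h1 := H.halving_pow hk x ht n
  rw [mul_inv_cancel₀ (by positivity)] at h1
  have h2 := H.left_le x _ ht
  have h3 : (k / (k + 1)) ^ n * (h (x + 1) - h x) ≤
      (k / (k + 1)) ^ n * (|h (x + 1)| + |h x|) := by
    gcongr
    linarith [le_abs_self (h (x + 1)), neg_le_abs (h x)]
  obtain ⟨hy1, hy2⟩ := _root_.abs_le.1 hy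
  have h4 := H.mono (show y ≤ x + (2 ^ n)⁻¹ by linarith)
  have h5 := H.mono (show x - (2 ^ n)⁻¹ ≤ y by linarith)
  have h6 := H.mono (show x ≤ x + (2 ^ n)⁻¹ by linarith)
  rw [_root_.abs_le]
  constructor <;> nlinarith

theorem exists_delta (hk : 0 < k) (x : ℝ) {ε : ℝ} (hε : 0 < ε) :
    ∃ δ > 0, ∀ h, NormalizedQS k h → ∀ y, |y - x| ≤ δ → |h y - h x| < ε := by
  set C := (1 + k) * (1 + k) ^ ⌈|x + 1|⌉₊ + (1 + k) * (1 + k) ^ ⌈|x|⌉₊ with hC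
  have hCpos : 0 < C := by positivity
  obtain ⟨n, hn⟩ := exists_pow_lt_of_lt_one (show 0 < ε / ((1 + k) * C) by positivity)
    (show k / (k + 1) < 1 by rw [div_lt_one] <;> linarith)
  refine ⟨(2 ^ n)⁻¹, by positivity, fun h H y hy => (H.abs_sub_le hk x n hy).trans_lt ?_⟩
  rw [lt_div_iff₀ (by positivity)] at hn
  calc _ ≤ (1 + k) * ((k / (k + 1)) ^ n * C) := by
        gcongr
        exact add_le_add (H.abs_le hk _) (H.abs_le hk _)
    _ < ε := by linarith

theorem continuous (H : NormalizedQS k h) (hk : 0 < k) : Continuous h := by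
  rw [Metric.continuous_iff]
  intro x ε hε
  obtain ⟨δ, hδ, hd⟩ := exists_delta hk x hε
  exact ⟨δ, hδ, fun y hy => hd h H y hy.le⟩

/-- `NormalizedQS` asks only for monotonicity, which survives pointwise limits. If `h` were flat on
`[a, b]`, doubling would spread this to the right of `a` and `left_le` to the left, contradicting `h
0 ≠ h 1`. -/
theorem strictMono (H : NormalizedQS k h) (hk : 0 < k) : StrictMono h := by
  refine H.mono.strictMono_of_injective ?_
  suffices ∀ a b, a < b → h a ≠ h b by
    intro a b hab
    by_contra hne
    rcases lt_or_gt_of_ne hne with h' | h'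
    · exact this a b h' hab
    · exact this b a h' hab.symm
  intro a b hab he
  have right : ∀ s, 0 < s → h (a + s) = h a := by
    intro s hs
    obtain ⟨n, hn⟩ := pow_unbounded_of_one_lt (s / (b - a)) one_lt_two
    rw [div_lt_iff₀ (by linarith)] at hn
    have h1 := H.doubling_pow hk a (sub_pos.2 hab) n
    rw [show a + (b - a) = b by ring, he, sub_self, mul_zero, ← he] at h1
    have h2 := H.mono (show a + s ≤ a + 2 ^ n * (b - a) by linarith)
    have h3 := H.mono (show a ≤ a + s by linarith)
    linarith
  have left : ∀ s, 0 < s → h (a - s) = h a := by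
    intro s hs
    have h1 := H.left_le a s hs
    rw [right s hs, sub_self, mul_zero] at h1
    have h2 := H.mono (show a - s ≤ a by linarith)
    linarith
  have const : ∀ x, h x = h a := by
    intro x
    rcases lt_trichotomy x a with hx | rfl | hx
    · simpa using left (a - x) (by linarith)
    · rfl
    · simpa using right (x - a) (by linarith)
  have := (const 0).trans (const 1).symm
  rw [H.zero, H.one] at this
  exact zero_ne_one this

/-- Uniform properness: halving from `2 ^ n` down to `1` forces `h (2 ^ n)` to be large, and
`right_le` at `0` transfers this to `-2 ^ n`. It yields surjectivity and controls convergence at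
`∞`. -/
theorem exists_uniform_bound (hk : 0 < k) (R : ℝ) :
    ∃ M : ℝ, ∀ h, NormalizedQS k h → R < h M ∧ h (-M) < -R := by
  obtain ⟨n, hn⟩ := exists_pow_lt_of_lt_one (show 0 < ((|R| + 1) * (1 + k))⁻¹ by positivity)
    (show k / (k + 1) < 1 by rw [div_lt_one] <;> linarith)
  refine ⟨2 ^ n, fun h H => ?_⟩
  have h1 := H.halving_pow hk 0 one_pos n
  have h2 := H.right_le 0 (2 ^ n) (by positivity)
  simp only [zero_add, zero_sub, mul_one, H.zero, H.one, sub_zero] at h1 h2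
  have hR := le_abs_self R
  have hR' := abs_nonneg R
  have h3 : (|R| + 1) * (1 + k) < h (2 ^ n) := by
    have hq : 0 < (k / (k + 1)) ^ n := by positivity
    rw [lt_inv_comm₀ hq (by positivity)] at hn
    refine hn.trans_le ?_
    rw [inv_le_iff_one_le_mul₀ hq]
    linarith
  constructor <;> nlinarith

theorem surjective (H : NormalizedQS k h) (hk : 0 < k) : Function.Surjective h := by
  refine (H.continuous hk).surjective ?_ ?_
  · refine tendsto_atTop_atTop_of_monotone H.mono fun R => ?_
    obtain ⟨M, hM⟩ := exists_uniform_bound hk R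
    exact ⟨M, (hM h H).1.le⟩
  · refine tendsto_atBot_atBot_of_monotone H.mono fun R => ?_
    obtain ⟨M, hM⟩ := exists_uniform_bound hk (-R)
    exact ⟨-M, by have := (hM h H).2; linarith⟩

theorem isClosed_setOf (k : ℝ) : IsClosed {h : ℝ → ℝ | NormalizedQS k h} := by
  have : {h : ℝ → ℝ | NormalizedQS k h} =
      {h | Monotone h} ∩ {h | h 0 = 0} ∩ {h | h 1 = 1} ∩
      (⋂ x : ℝ, ⋂ t : ℝ, ⋂ _ : 0 < t, {h | h (x + t) - h x ≤ k * (h x - h (x - t))}) ∩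
      (⋂ x : ℝ, ⋂ t : ℝ, ⋂ _ : 0 < t, {h | h x - h (x - t) ≤ k * (h (x + t) - h x)}) := by
    ext h
    simp only [Set.mem_inter_iff, Set.mem_iInter, Set.mem_ofPred_eq]
    exact ⟨fun H => ⟨⟨⟨⟨H.1, H.2⟩, H.3⟩, H.4⟩, H.5⟩,
      fun H => ⟨H.1.1.1.1, H.1.1.1.2, H.1.1.2, H.1.2, H.2⟩⟩
  rw [this]
  refine (((isClosed_monotone.inter ?_).inter ?_).inter ?_).inter ?_
  · exact isClosed_eq (continuous_apply _) continuous_const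
  · exact isClosed_eq (continuous_apply _) continuous_const
  · exact isClosed_iInter fun x => isClosed_iInter fun t => isClosed_iInter fun _ =>
      isClosed_le (by fun_prop) (by fun_prop)
  · exact isClosed_iInter fun x => isClosed_iInter fun t => isClosed_iInter fun _ =>
      isClosed_le (by fun_prop) (by fun_prop)

theorem isCompact_setOf (hk : 0 < k) : IsCompact {h : C(ℝ, ℝ) | NormalizedQS k h} := by
  refine ArzelaAscoli.isCompact_of_equicontinuous _ ?_ ?_
  · have : ContinuousMap.toFun '' {h : C(ℝ, ℝ) | NormalizedQS k h} =
        {h : ℝ → ℝ | NormalizedQS k h} := by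
      ext h
      constructor
      · rintro ⟨g, hg, rfl⟩
        exact hg
      · intro hh
        exact ⟨⟨h, NormalizedQS.continuous hh hk⟩, hh, rfl⟩
    rw [this]
    refine (isCompact_univ_pi fun x => isCompact_closedBall (0 : ℝ)
      ((1 + k) * (1 + k) ^ ⌈|x|⌉₊)).of_isClosed_subset (isClosed_setOf k) fun h hh x _ => ?_
    simpa using NormalizedQS.abs_le hh hk x
  · intro x
    rw [Metric.equicontinuousAt_iff]
    intro ε hε
    obtain ⟨δ, hδ, hd⟩ := exists_delta hk x hε
    refine ⟨δ, hδ, fun y hy f => ?_⟩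
    rw [dist_comm, Real.dist_eq]
    exact hd _ f.2 y hy.le

/-- Locally uniform convergence on `ℝ` handles finite points; at `∞` the uniform bound replaces it.
-/
theorem exists_subseq (hk : 0 < k) {h : ℕ → ℝ → ℝ} (H : ∀ n, NormalizedQS k (h n)) :
    ∃ s : ℕ → ℕ, StrictMono s ∧ ∃ g : RHat ≃ₜ RHat, ∀ x,
      Tendsto (fun p : ℕ × RHat => OnePoint.map (h (s p.1)) p.2) (atTop ×ˢ 𝓝 x) (𝓝 (g x)) := by
  obtain ⟨G, hG, s, hs, hlim⟩ := (isCompact_setOf hk).tendsto_subseq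
    (x := fun n => ⟨h n, (H n).continuous hk⟩) H
  let e : ℝ ≃ₜ ℝ := (StrictMono.orderIsoOfSurjective G (NormalizedQS.strictMono hG hk)
    (NormalizedQS.surjective hG hk)).toHomeomorph
  refine ⟨s, hs, e.onePointCongr, fun x => ?_⟩
  induction x using OnePoint.rec with
  | coe x =>
    change Tendsto _ _ (𝓝 ((G x : ℝ) : RHat))
    rw [OnePoint.nhds_coe_eq x, OnePoint.nhds_coe_eq, prod_map_right, tendsto_map'_iff]
    refine tendsto_map.comp (x := atTop ×ˢ 𝓝 x) (f := fun p : ℕ × ℝ => h (s p.1) p.2) ?_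
    have h1 : Tendsto (fun q : C(ℝ, ℝ) × ℝ => q.1 q.2) (𝓝 (G, x)) (𝓝 (G x)) :=
      continuous_eval.tendsto (G, x)
    exact h1.comp ((hlim.comp tendsto_fst).prodMk_nhds tendsto_snd)
  | infty =>
    change Tendsto _ _ (𝓝 ∞)
    rw [Tendsto, OnePoint.le_nhds_infty]
    intro K _ hK
    obtain ⟨R, hR⟩ := hK.isBounded.exists_norm_le
    obtain ⟨M, hM⟩ := exists_uniform_bound hk R
    have hU : (((↑) : ℝ → RHat) '' Set.Icc (-M) M)ᶜ ∈ 𝓝 (∞ : RHat) :=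
      (OnePoint.isOpen_compl_image_coe.2 ⟨isClosed_Icc, isCompact_Icc⟩).mem_nhds (by simp)
    rw [mem_map]
    filter_upwards [tendsto_snd.eventually hU] with p hp
    rw [Set.mem_preimage, ← OnePoint.compl_image_coe]
    rintro ⟨y, hy, hyp⟩
    obtain ⟨n, x⟩ := p
    induction x using OnePoint.rec with
    | infty => simp at hyp
    | coe x =>
      simp only [OnePoint.map_some, OnePoint.coe_eq_coe] at hyp
      simp only [Set.mem_image, OnePoint.coe_eq_coe, exists_eq_right,
        Set.mem_Icc, not_and_or, not_le] at hp
      have hb := hM _ (H (s n))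
      have := _root_.abs_le.1 (hR y hy)
      rcases hp with hp | hp
      · have := (H (s n)).mono hp.le
        linarith
      · have := (H (s n)).mono hp.le
        linarith

end NormalizedQS

/-! ### Möbius normalisation and the two implications -/

theorem OrientationPreserving.exists_strictMono {f : RHat ≃ₜ RHat} (hf : OrientationPreserving f)
    (h : f ∞ = ∞) : ∃ u : ℝ → ℝ, StrictMono u ∧ ∀ x : ℝ, f (x : RHat) = (u x : RHat) := by
  have : ∀ x : ℝ, ∃ y : ℝ, f (x : RHat) = (y : RHat) := fun x => by
    have hx : f (x : RHat) ≠ ∞ := fun hx =>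
      OnePoint.coe_ne_infty x (f.injective (hx.trans h.symm))
    obtain ⟨y, hy⟩ := OnePoint.ne_infty_iff_exists.1 hx
    exact ⟨y, hy.symm⟩
  choose u hu using this
  refine ⟨u, fun x y hxy => ?_, hu⟩
  have := hf ∞ (x : RHat) (y : RHat) hxy
  rw [h, hu, hu] at this
  exact this

/-- An affine `β` rescales `h` to fix `0` and `1`, and `ψ` is the inverse of `β ∘ φ`. Invariance of
the family supplies `hop`, so orientation need not be checked for Möbius maps themselves. -/
theorem IsQuasisymmetric.exists_normalized {k : ℝ} (hk : 0 < k) {f : RHat ≃ₜ RHat}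
    (hf : IsQuasisymmetric k f) (hop : ∀ φ ∈ Moeb, OrientationPreserving (f.trans φ)) :
    ∃ ψ ∈ Moeb, ∃ u : ℝ → ℝ, NormalizedQS k u ∧ ∀ x, f x = ψ (OnePoint.map u x) := by
  obtain ⟨-, φ, hφ, hinf, h, hh, hqs⟩ := hf
  obtain ⟨h', hmono, hh'⟩ := (hop φ hφ).exists_strictMono hinf
  obtain rfl : h = h' := funext fun x => OnePoint.coe_injective ((hh x).symm.trans (hh' x))
  have hpos : 0 < h 1 - h 0 := sub_pos.2 (hmono one_pos)
  obtain ⟨β, hβ, hβi, hβr⟩ := exists_moeb_affine (inv_pos.2 hpos) (-((h 1 - h 0)⁻¹ * h 0))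
  have hineq : ∀ x t, 0 < t → h (x + t) - h x ≤ k * (h x - h (x - t)) ∧
      h x - h (x - t) ≤ k * (h (x + t) - h x) := fun x t ht => by
    have h1 : 0 < h x - h (x - t) := sub_pos.2 (hmono (by linarith))
    obtain ⟨h2, h3⟩ := hqs x t ht
    rw [div_le_iff₀ h1] at h3
    rw [div_le_div_iff₀ hk h1] at h2
    constructor <;> linarith
  refine ⟨(φ.trans β).symm, Moeb.symm_mem (Moeb.trans_mem hφ hβ),
    fun x => (h 1 - h 0)⁻¹ * h x + -((h 1 - h 0)⁻¹ * h 0), ⟨?_, ?_, ?_, ?_, ?_⟩, fun x => ?_⟩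
  · intro x y hxy
    have := hmono.monotone hxy
    dsimp only
    gcongr
  · simp
  · field_simp
    ring
  · intro x t ht
    have := mul_le_mul_of_nonneg_left (hineq x t ht).1 (inv_pos.2 hpos).le
    linarith
  · intro x t ht
    have := mul_le_mul_of_nonneg_left (hineq x t ht).2 (inv_pos.2 hpos).le
    linarith
  · rw [eq_comm, Homeomorph.symm_apply_eq, Homeomorph.trans_apply]
    induction x using OnePoint.rec with
    | infty => rw [hinf, hβi, OnePoint.map_infty]
    | coe x => rw [hh, hβr, OnePoint.map_some]

theorem UniformlyQuasisymmetric.hasConvergenceProperty {F : Set (RHat ≃ₜ RHat)}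
    (hF : ∀ f ∈ F, OrientationPreserving f) (hpost : ∀ f ∈ F, ∀ φ ∈ Moeb, f.trans φ ∈ F)
    (h : UniformlyQuasisymmetric F) : HasConvergenceProperty F := by
  obtain ⟨k, hk, hqs⟩ := h
  intro f hf
  choose ψ hψ u hu hfu using fun n => (hqs _ (hf n)).exists_normalized hk
    fun φ hφ => hF _ (hpost _ (hf n) φ hφ)
  obtain ⟨s, hs, g, hg⟩ := NormalizedQS.exists_subseq hk hu
  obtain ⟨s', hs', hlim⟩ := moeb_exists_subseq fun n => hψ (s n)
  have hg' : ∀ x, Tendsto (fun p : ℕ × RHat => (p.1, OnePoint.map (u (s (s' p.1))) p.2))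
      (atTop ×ˢ 𝓝 x) (atTop ×ˢ 𝓝 (g x)) := fun x =>
    tendsto_fst.prodMk ((hg x).comp ((hs'.tendsto_atTop.comp tendsto_fst).prodMk tendsto_snd))
  refine ⟨s ∘ s', hs.comp hs', ?_⟩
  simp only [Function.comp_apply]
  rcases hlim with ⟨θ, -, hθ⟩ | ⟨a, r, har⟩
  · left
    have hconv : ∀ x, Tendsto (fun p : ℕ × RHat => f (s (s' p.1)) p.2) (atTop ×ˢ 𝓝 x)
        (𝓝 ((g.trans θ) x)) := fun x => by
      simp only [hfu]
      exact (hθ (g x)).comp (hg' x)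
    refine ⟨g.trans θ, OrientationPreserving.of_tendsto (fun n => hF _ (hf (s (s' n)))) fun x => ?_,
      uniformlyConvergesOn_of_tendsto isCompact_univ (g.trans θ).continuous.continuousOn
        fun x _ => hconv x⟩
    exact (hconv x).comp (tendsto_id.prodMk (tendsto_const_nhds (x := x)))
  · right
    -- The normalised factors tend to `g`, so the repeller `r` of the Möbius factors is pulled back
    -- by `g`.
    refine ⟨a, g.symm r, fun U hU hrU => ?_⟩
    refine uniformlyConvergesOn_of_tendsto hU.isClosed_compl.isCompact continuousOn_const
      fun x hx => ?_
    simp only [hfu]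
    refine (har (g x) fun hgx => hx ?_).comp (hg' x)
    rwa [← hgx, Homeomorph.symm_apply_apply] at hrU

/-- A map that is not `k`-quasisymmetric can be normalised to fix `0`, `1` and `∞` and to
map `-1` to the outside of `[-k, -1 / k]`. -/
theorem exists_normalized_of_not_isQuasisymmetric {F : Set (RHat ≃ₜ RHat)}
    (hF : ∀ f ∈ F, OrientationPreserving f) (hpost : ∀ f ∈ F, ∀ φ ∈ Moeb, f.trans φ ∈ F)
    (hpre : ∀ f ∈ F, ∀ φ ∈ Moeb, φ.trans f ∈ F) {k : ℝ} (hk : 0 < k) {f : RHat ≃ₜ RHat}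
    (hf : f ∈ F) (hqs : ¬ IsQuasisymmetric k f) :
    ∃ g ∈ F, g ∞ = ∞ ∧ g ((0 : ℝ) : RHat) = ((0 : ℝ) : RHat) ∧
      g ((1 : ℝ) : RHat) = ((1 : ℝ) : RHat) ∧
      ∃ c : ℝ, g ((-1 : ℝ) : RHat) = (c : RHat) ∧ c < 0 ∧ (c < -k ∨ -(1 / k) < c) := by
  obtain ⟨φ, hφ, hinf⟩ := exists_moeb_map_infty (f ∞)
  obtain ⟨h, hmono, hh⟩ := (hF _ (hpost f hf φ hφ)).exists_strictMono hinf
  obtain ⟨x, t, ht, hxt⟩ : ∃ x t : ℝ, 0 < t ∧ ¬ (1 / k ≤ (h (x + t) - h x) / (h x - h (x - t)) ∧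
      (h (x + t) - h x) / (h x - h (x - t)) ≤ k) := by
    by_contra! hcon
    exact hqs ⟨hF f hf, φ, hφ, hinf, h, hh, hcon⟩
  have h1 : 0 < h x - h (x - t) := sub_pos.2 (hmono (by linarith))
  have h2 : 0 < h (x + t) - h x := sub_pos.2 (hmono (by linarith))
  -- `α` sends `-1, 0, 1` to `x - t, x, x + t`, and `β` sends `h x, h (x + t)` to `0, 1`; hence `-1`
  -- goes to minus the reciprocal of the quasisymmetry ratio.
  obtain ⟨α, hα, hαi, hαr⟩ := exists_moeb_affine ht x
  obtain ⟨β, hβ, hβi, hβr⟩ :=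
    exists_moeb_affine (inv_pos.2 h2) (-((h (x + t) - h x)⁻¹ * h x))
  have key : ∀ y : ℝ, (α.trans ((f.trans φ).trans β)) (y : RHat) =
      (((h (t * y + x) - h x) / (h (x + t) - h x) : ℝ) : RHat) := fun y => by
    rw [Homeomorph.trans_apply, hαr, Homeomorph.trans_apply, hh, hβr, OnePoint.coe_eq_coe]
    field_simp
    ring
  refine ⟨α.trans ((f.trans φ).trans β), hpre _ (hpost _ (hpost f hf φ hφ) β hβ) α hα, ?_, ?_, ?_,
    _, key (-1), ?_, ?_⟩
  · rw [Homeomorph.trans_apply, hαi, Homeomorph.trans_apply, Homeomorph.trans_apply, hinf, hβi]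
  · simp [key]
  · rw [key, mul_one, add_comm t x, div_self h2.ne']
  · rw [show t * -1 + x = x - t by ring]
    exact div_neg_of_neg_of_pos (by linarith) h2
  · rw [show t * -1 + x = x - t by ring, div_lt_iff₀ h2, lt_div_iff₀ h2]
    by_contra! hcon
    refine hxt ⟨?_, ?_⟩
    · rw [div_le_div_iff₀ hk h1]
      linarith
    · rw [div_le_iff₀ h1]
      have := hcon.2
      rw [neg_mul, le_neg, one_div, inv_mul_le_iff₀ hk] at this
      linarith

theorem HasConvergenceProperty.uniformlyQuasisymmetric {F : Set (RHat ≃ₜ RHat)}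
    (hF : ∀ f ∈ F, OrientationPreserving f) (hpost : ∀ f ∈ F, ∀ φ ∈ Moeb, f.trans φ ∈ F)
    (hpre : ∀ f ∈ F, ∀ φ ∈ Moeb, φ.trans f ∈ F) (h : HasConvergenceProperty F) :
    UniformlyQuasisymmetric F := by
  by_contra hcon
  simp only [UniformlyQuasisymmetric, not_exists, not_and, not_forall] at hcon
  have hseq : ∀ n : ℕ, ∃ g ∈ F, g ∞ = ∞ ∧ g ((0 : ℝ) : RHat) = ((0 : ℝ) : RHat) ∧
      g ((1 : ℝ) : RHat) = ((1 : ℝ) : RHat) ∧ ∃ c : ℝ, g ((-1 : ℝ) : RHat) = (c : RHat) ∧ c < 0 ∧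
      (c < -((n : ℝ) + 1) ∨ -(1 / ((n : ℝ) + 1)) < c) := fun n => by
    obtain ⟨f, hf, hqs⟩ := hcon (n + 1) (by positivity)
    exact exists_normalized_of_not_isQuasisymmetric hF hpost hpre (by positivity) hf hqs
  choose g hgF hgi hg0 hg1 c hc hc0 hcn using hseq
  obtain ⟨s, hs, ⟨G, -, hG⟩ | ⟨a, r, har⟩⟩ := h g hgF
  · have hi := hG.tendsto_at (Set.mem_univ ∞)
    have h0 := hG.tendsto_at (Set.mem_univ ((0 : ℝ) : RHat))
    have hm := hG.tendsto_at (Set.mem_univ ((-1 : ℝ) : RHat))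
    simp only [hgi, hg0, hc, tendsto_const_nhds_iff] at hi h0 hm
    have hne : G ((-1 : ℝ) : RHat) ≠ ∞ := by
      rw [hi]
      exact G.injective.ne (OnePoint.coe_ne_infty _)
    obtain ⟨l, hl⟩ := OnePoint.ne_infty_iff_exists.1 hne
    have hl0 : l ≠ 0 := by
      rintro rfl
      rw [h0] at hl
      have := G.injective hl
      rw [OnePoint.coe_eq_coe] at this
      norm_num at this
    have hlim : Tendsto (fun n => c (s n)) atTop (𝓝 l) := by
      rw [← hl] at hm
      rwa [← OnePoint.comap_coe_nhds, tendsto_comap_iff]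
    have hinv : Tendsto (fun n => 1 / ((s n : ℝ) + 1)) atTop (𝓝 0) :=
      tendsto_one_div_add_atTop_nhds_zero_nat.comp hs.tendsto_atTop
    have hl0' : l < 0 := lt_of_le_of_ne (le_of_tendsto' hlim fun n => (hc0 _).le) hl0
    -- Since `c (s n)` tends to a finite `l < 0`, `e1` excludes values just below `0`, while `e2`
    -- and `e3` exclude values below `-(s n + 1)`.
    have e1 := hlim.add hinv |>.eventually_lt_const (u := 0) (by simpa using hl0')
    have e2 := hlim.eventually_const_lt (sub_one_lt l)
    have e3 := (tendsto_natCast_atTop_atTop.comp hs.tendsto_atTop).eventually_ge_atTop (1 - l)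
    obtain ⟨n, ⟨h1, h2⟩, h3⟩ := ((e1.and e2).and e3).exists
    simp only [Function.comp_apply] at h3
    rcases hcn (s n) with h4 | h4 <;> linarith
  -- Every common fixed point other than `r` equals `a`, yet at least two of `0`, `1`, `∞` differ
  -- from `r`.
  · have key : ∀ x, x ≠ r → (∀ n, g n x = x) → x = a := by
      intro x hx hfix
      have := (har {x}ᶜ isOpen_compl_singleton (by simpa using hx.symm)).tendsto_at
        (x := x) (by simp)
      simpa only [hfix, tendsto_const_nhds_iff] using this
    have k0 := fun hr => key _ hr hg0
    have k1 := fun hr => key _ hr hg1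
    have ki := fun hr => key _ hr hgi
    have n01 : ((0 : ℝ) : RHat) ≠ ((1 : ℝ) : RHat) := by simp
    have n0i : ((0 : ℝ) : RHat) ≠ ∞ := by simp
    have n1i : ((1 : ℝ) : RHat) ≠ ∞ := by simp
    by_cases hr0 : ((0 : ℝ) : RHat) = r
    · exact n1i ((k1 fun h => n01 (hr0.trans h.symm)).trans
        (ki fun h => n0i (hr0.trans h.symm)).symm)
    · by_cases hr1 : ((1 : ℝ) : RHat) = r
      · exact n0i ((k0 hr0).trans (ki fun h => n1i (hr1.trans h.symm)).symm)
      · exact n01 ((k0 hr0).trans (k1 hr1).symm)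

end RHat

theorem proposition3p2 (F : Set (RHat ≃ₜ RHat))
    (hF : ∀ f ∈ F, RHat.OrientationPreserving f)
    (hpost : ∀ f ∈ F, ∀ φ ∈ RHat.Moeb, f.trans φ ∈ F)
    (hpre : ∀ f ∈ F, ∀ φ ∈ RHat.Moeb, φ.trans f ∈ F) :
    RHat.HasConvergenceProperty F ↔ RHat.UniformlyQuasisymmetric F :=
  ⟨fun h => h.uniformlyQuasisymmetric hF hpost hpre,
    fun h => h.hasConvergenceProperty hF hpost⟩
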